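/- Let $\mathcal V$ be a finite set of nodes and $\mathcal F$ a finite set of flows. Node $v$ has capacity $c_v\ge 0$ and cost $b_v>0$; flow $f$ has rate $\lambda_f\ge 0$ and a path whose node set is $\mathcal V_f\subseteq\mathcal V$; the budget is $B\ge 0$. Assume $\lambda_f\le c_v$ for all $f$ and $v$. A feasible solution of the VNF-node placement and capacity allocation problem (VPCA) is a set $\mathcal U\subseteq\mathcal V$ with $\sum_{v\in\mathcal U}b_v\le B$ together with numbers $\lambda_f^v\ge 0$ such that $\sum_f\lambda_f^v\le c_v$ for $v\in\mathcal U$ and $\lambda_f^v=0$ for $v\notin\mathcal U$. Its value $J_1(\mathcal U,\boldsymbol\lambda)$ is the sum of the rates $\lambda_f$ of the fully processed flows, i.e. of those $f$ with $\sum_{v\in\mathcal V_f\cap\mathcal U}\lambda_f^v\ge\lambda_f$. VPCA asks to maximize this value. For $\mathcal U\subseteq\mathcal V$, let $R_3(\mathcal U)$ be the maximum of $\sum_f\sum_{v\in\mathcal V_f\cap\mathcal U}\lambda_f^v$ over all $\lambda_f^v\ge0$ that satisfy the above capacity constraints (with $\lambda_f^v=0$ for $v\notin\mathcal U$) and $\sum_{v\in\mathcal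 U}\lambda_f^v\le\lambda_f$ for all $f$. The algorithm RP-GCA has two stages. 1. Placement: a set $\mathcal U$ is chosen by one of the following algorithms. - Submodular Greedy (if all costs equal one number $b$): starting from $\emptyset$, repeatedly add a node with the largest marginal gain of $R_3$, until $\min(\lfloor B/b\rfloor,|\mathcal V|)$ nodes have been chosen. - Enumeration-based Greedy (arbitrary costs): let $\mathcal U_1$ be a set with the largest $R_3$ among the sets of one or two nodes of total cost at most $B$. Augment each three-node set of total cost at most $B$ greedily: while some node can be added within the budget, add among these nodes $u$ one that maximizes $(R_3(\mathcal S\cup\{u\})-R_3(\mathcal S))/b_u$, where $\mathcal S$ is the current set. Let $\mathcal U_2$ be an augmented set with the largest $R_3$. Output whichever of $\mathcal U_1,\mathcal U_2$ has the larger $R_3$ (where $\mathcal U_i=\emptyset$ if there is no candidate for it). 2. Greedy capacity allocation (GCA): sort the flows $f$ with $\mathcal V_f\cap\mathcal U\neq\emptyset$ in nonincreasing order of their rates. In Phase I go through the list and assign each flow $f$ entirely to any node of $\mathcal V_f\cap\mathcal U$ whose remaining capacity is at least $\lambda_f$, if there is one; otherwise skip $f$. In Phase II go through the flows not yet assigned,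 in the same order; if the total remaining capacity of the nodes of $\mathcal V_f\cap\mathcal U$ is at least $\lambda_f$, assign $f$ fully to these nodes, split among them in any way that respects the remaining capacities; otherwise skip $f$. Theorem. RP-GCA, with either placement algorithm (Submodular Greedy when the costs are uniform), is a $\frac13(1-1/e)$-approximation algorithm for VPCA: it always has an output, and for every possible output $(\mathcal U,\boldsymbol\lambda)$, whatever choices are made (tie-breaking, order of flows of equal rate, choice of nodes and of splittings), $(\mathcal U,\boldsymbol\lambda)$ is feasible for VPCA and $$J_1(\mathcal U,\boldsymbol\lambda)\ \ge\ \tfrac13\left(1-\tfrac1e\right)J_1(\mathcal U',\boldsymbol\lambda')$$ for every feasible solution $(\mathcal U',\boldsymbol\lambda')$ of VPCA. -/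

import Mathlib

noncomputable section

namespace VPCA

/-- Input data of the joint VNF-node placement and capacity allocation problem, with nodes `V` and
flows `F`.  Only the set of nodes on the (predetermined) path of a flow enters the problem, so a
path is recorded through its node set; arbitrary node sets are allowed. -/
structure Network (V F : Type*) where
  /-- the node set of the path of each flow -/
  path : F → Finset V
  /-- the traffic rate of each flow -/
  rate : F → ℝ
  /-- the processing capacity of each node -/
  cap : V → ℝ
  /-- the cost of making a node a VNF-node -/
  cost : V → ℝ
  /-- the total budget -/
  budget : ℝ

namespace Network

variable {V F : Type*} [Fintype V] [DecidableEq V] [Fintype F] [DecidableEq F]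

/-- The VNF-nodes on the path of the flow `f`. -/
def nodesOn (N : Network V F) (U : Finset V) (f : F) : Finset V := N.path f ∩ U

/-- The budget constraint. -/
def Affordable (N : Network V F) (U : Finset V) : Prop := ∑ v ∈ U, N.cost v ≤ N.budget

/-- The capacity constraint for an assignment `x`, where `x f v` is the portion of flow `f` that is
assigned to node `v`: portions are nonnegative, loads of VNF-nodes do not exceed the capacities,
and nothing is assigned outside `U`. -/
def CapacityFeasible (N : Network V F) (U : Finset V) (x : F → V → ℝ) : Prop :=
  (∀ f v, 0 ≤ x f v) ∧ (∀ v ∈ U, ∑ f, x f v ≤ N.cap v) ∧ ∀ f, ∀ v ∉ U, x f v = 0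

/-- The feasible solutions of the VPCA problem. -/
def Feasible (N : Network V F) (U : Finset V) (x : F → V → ℝ) : Prop :=
  N.Affordable U ∧ N.CapacityFeasible U x

/-- The objective of the VPCA problem: the total rate of the fully processed flows. -/
def fullyProcessed (N : Network V F) (U : Finset V) (x : F → V → ℝ) : ℝ :=
  ∑ f, if N.rate f ≤ ∑ v ∈ N.nodesOn U f, x f v then N.rate f else 0

/-- The feasible assignments of the relaxed allocation problem for given VNF-nodes `U`: in addition
to the capacity constraint, no flow is processed beyond its rate. -/
def relaxedAssignments (N : Network V F) (U : Finset V) : Set (F → V → ℝ) :=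
  {x | N.CapacityFeasible U x ∧ ∀ f, ∑ v ∈ U, x f v ≤ N.rate f}

/-- The objective of the relaxed problem, where partially processed flows count. -/
def relaxedTraffic (N : Network V F) (U : Finset V) (x : F → V → ℝ) : ℝ :=
  ∑ f, ∑ v ∈ N.nodesOn U f, x f v

/-- The optimal value of the relaxed allocation problem for given VNF-nodes `U`; this is the
objective of the relaxed placement problem. -/
def relaxedValue (N : Network V F) (U : Finset V) : ℝ :=
  sSup (N.relaxedTraffic U '' N.relaxedAssignments U)

/-! ### Relaxed placement

The algorithms contain arbitrary choices (ties among them), so they are given by the relation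
between the input and all possible outputs. -/

/-- `N.GreedyRun n U`: `n` iterations of Submodular Greedy, started from the empty set, can lead to
`U`.  Each iteration adds a node of maximum marginal contribution. -/
inductive GreedyRun (N : Network V F) : ℕ → Finset V → Prop
  | zero : GreedyRun N 0 ∅
  | succ {n : ℕ} {U : Finset V} {u : V} (run : GreedyRun N n U) (hu : u ∉ U)
      (best : ∀ w ∉ U, N.relaxedValue (insert w U) - N.relaxedValue U ≤
        N.relaxedValue (insert u U) - N.relaxedValue U) :
      GreedyRun N (n + 1) (insert u U)

/-- Output of Submodular Greedy, for a uniform node cost `b`: nodes are added until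
`k = ⌊B / b⌋` nodes (or all of the nodes, if there are fewer than `k`) have been selected. -/
def IsSubmodularGreedy (N : Network V F) (U : Finset V) : Prop :=
  ∃ b : ℝ, 0 < b ∧ (∀ v, N.cost v = b) ∧
    N.GreedyRun (min ⌊N.budget / b⌋₊ (Fintype.card V)) U

/-- The marginal contribution of `u` to `S`, relative to the cost of `u`. -/
def relativeGain (N : Network V F) (S : Finset V) (u : V) : ℝ :=
  (N.relaxedValue (insert u S) - N.relaxedValue S) / N.cost u

/-- The nodes that can be added to `S` within the budget. -/
def CanAdd (N : Network V F) (S : Finset V) (u : V) : Prop :=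
  u ∉ S ∧ N.Affordable (insert u S)

/-- One greedy augmentation step: among the nodes that can be added within the budget, a node of
maximum relative marginal contribution is added. -/
def AugmentStep (N : Network V F) (S S' : Finset V) : Prop :=
  ∃ u, N.CanAdd S u ∧ (∀ w, N.CanAdd S w → N.relativeGain S w ≤ N.relativeGain S u) ∧
    S' = insert u S

/-- `T` is obtained from `S` by greedy augmentation steps, continued as long as possible. -/
def GreedilyAugments (N : Network V F) (S T : Finset V) : Prop :=
  Relation.ReflTransGen N.AugmentStep S T ∧ ∀ u, ¬ N.CanAdd T u

/-- `U` is a member of `C` with the largest relaxed value (and `U = ∅` if `C` is empty). -/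
def IsBest (N : Network V F) (C : Set (Finset V)) (U : Finset V) : Prop :=
  (C.Nonempty → U ∈ C ∧ ∀ S ∈ C, N.relaxedValue S ≤ N.relaxedValue U) ∧ (C = ∅ → U = ∅)

/-- The affordable three-element node sets, from which the second phase of Enumeration-based
Greedy starts. -/
def triples (N : Network V F) : Set (Finset V) := {S | N.Affordable S ∧ S.card = 3}

/-- Output of Enumeration-based Greedy.  `U₁` is a best affordable set with one or two nodes; every
affordable set `S` with three nodes is greedily augmented to a set `aug S`, and `U₂` is a best one
of these; the output is the better one of `U₁` and `U₂`. -/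
def IsEnumerationGreedy (N : Network V F) (U : Finset V) : Prop :=
  ∃ (U₁ U₂ : Finset V) (aug : Finset V → Finset V),
    N.IsBest {S | N.Affordable S ∧ (S.card = 1 ∨ S.card = 2)} U₁ ∧
    (∀ S ∈ N.triples, N.GreedilyAugments S (aug S)) ∧
    N.IsBest (aug '' N.triples) U₂ ∧
    (U = U₁ ∨ U = U₂) ∧ N.relaxedValue U₁ ≤ N.relaxedValue U ∧
    N.relaxedValue U₂ ≤ N.relaxedValue U

/-! ### Greedy capacity allocation -/

/-- The flows whose path meets `U`. -/
def flowsThrough (N : Network V F) (U : Finset V) : Finset F :=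
  Finset.univ.filter fun f => (N.nodesOn U f).Nonempty

/-- The list `l` enumerates the flows through `U` in nonincreasing order of their rates. -/
def IsSortedFlows (N : Network V F) (U : Finset V) (l : List F) : Prop :=
  l.Nodup ∧ (∀ f, f ∈ l ↔ f ∈ N.flowsThrough U) ∧ l.Pairwise fun f g => N.rate g ≤ N.rate f

/-- The remaining capacity of the node `v` under the assignment `x`. -/
def remCap (N : Network V F) (x : F → V → ℝ) (v : V) : ℝ := N.cap v - ∑ f, x f v

/-- `N.PhaseI U l x rest y`: Phase I, applied to the list `l` of flows with current assignment `x`,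
can end with the assignment `y` and the list `rest` of flows not yet assigned (in the same order).
A flow is assigned as a whole to any one of the VNF-nodes on its path with sufficient remaining
capacity; it is skipped if there is none. -/
inductive PhaseI (N : Network V F) (U : Finset V) :
    List F → (F → V → ℝ) → List F → (F → V → ℝ) → Prop
  | nil (x : F → V → ℝ) : PhaseI N U [] x [] x
  | assign {f : F} {l rest : List F} {x y : F → V → ℝ} (v : V) (hv : v ∈ N.nodesOn U f)
      (fits : N.rate f ≤ N.remCap x v)
      (run : PhaseI N U l (Function.update x f (Pi.single v (N.rate f))) rest y) :
      PhaseI N U (f :: l) x rest y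
  | skip {f : F} {l rest : List F} {x y : F → V → ℝ}
      (none_fits : ∀ v ∈ N.nodesOn U f, N.remCap x v < N.rate f)
      (run : PhaseI N U l x rest y) :
      PhaseI N U (f :: l) x (f :: rest) y

/-- `N.PhaseII U l x y`: Phase II, applied to the list `l` of unassigned flows with current
assignment `x`, can end with the assignment `y`.  If the total remaining capacity of the VNF-nodes
on the path of a flow is at least its rate, the flow is fully assigned to these nodes, split in any
way `z` that respects the remaining capacities; otherwise it is skipped. -/
inductive PhaseII (N : Network V F) (U : Finset V) :
    List F → (F → V → ℝ) → (F → V → ℝ) → Prop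
  | nil (x : F → V → ℝ) : PhaseII N U [] x x
  | assign {f : F} {l : List F} {x y : F → V → ℝ} (z : V → ℝ)
      (fits : N.rate f ≤ ∑ v ∈ N.nodesOn U f, N.remCap x v)
      (nonneg : ∀ v, 0 ≤ z v) (supp : ∀ v ∉ N.nodesOn U f, z v = 0)
      (le_rem : ∀ v ∈ N.nodesOn U f, z v ≤ N.remCap x v)
      (total : ∑ v ∈ N.nodesOn U f, z v = N.rate f)
      (run : PhaseII N U l (Function.update x f z) y) :
      PhaseII N U (f :: l) x y
  | skip {f : F} {l : List F} {x y : F → V → ℝ}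
      (too_large : ∑ v ∈ N.nodesOn U f, N.remCap x v < N.rate f)
      (run : PhaseII N U l x y) :
      PhaseII N U (f :: l) x y

/-- Output of greedy capacity allocation (GCA) for the VNF-nodes `U`: starting from the zero
assignment, Phase I on a sorted list of the flows through `U`, then Phase II on the flows that are
still unassigned. -/
def IsGCA (N : Network V F) (U : Finset V) (y : F → V → ℝ) : Prop :=
  ∃ (l rest : List F) (x : F → V → ℝ),
    N.IsSortedFlows U l ∧ N.PhaseI U l 0 rest x ∧ N.PhaseII U rest x y

end Network

/-- The two placement algorithms. -/
inductive PlacementAlg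
  | submodularGreedy
  | enumerationGreedy

namespace Network

variable {V F : Type*} [Fintype V] [DecidableEq V] [Fintype F] [DecidableEq F]

/-- Submodular Greedy is for uniform node costs; Enumeration-based Greedy is for all costs. -/
def Applicable (N : Network V F) : PlacementAlg → Prop
  | .submodularGreedy => ∃ b, ∀ v, N.cost v = b
  | .enumerationGreedy => True

/-- Output of the relaxed placement by the chosen algorithm. -/
def IsPlacement (N : Network V F) : PlacementAlg → Finset V → Prop
  | .submodularGreedy, U => N.IsSubmodularGreedy U
  | .enumerationGreedy, U => N.IsEnumerationGreedy U

/-- `(U, x)` is a possible output of RP-GCA: relaxed placement, then greedy capacity allocation. -/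
def IsRPGCA (N : Network V F) (alg : PlacementAlg) (U : Finset V) (x : F → V → ℝ) : Prop :=
  N.IsPlacement alg U ∧ N.IsGCA U x

end Network

end VPCA

end

/-! The relaxed value $R_3$ links the two stages through the chain $(1-1/e)J_1(\mathcal
U',\lambda')\le(1-1/e)R_3(\mathcal U')\le R_3(\mathcal U)\le 3J_1(\mathcal U,\lambda)$.

Everything about $R_3$ comes from a min-cut formula (`exists_relaxedValue_eq_cut`): $R_3(\mathcal
U)$ is the minimum, over sets $T$ of flows, of the total rate outside $T$ plus the capacity of the
nodes of $\mathcal U$ on paths of flows in $T$. Cuts grow with $\mathcal U$ and can be uncrossed, so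
$R_3$ is monotone and submodular; each cut also bounds $J_1$. The middle inequality is then greedy
maximization of a monotone submodular function under a cardinality bound or, with enumeration of
triples, a knapsack constraint.

For the last inequality (`IsGCA.spec`), every VNF-node on the path of a flow skipped in Phase I is
at least half full. Taking for $T$ the flows not assigned in Phase I gives a cut of at most the
assigned rate plus twice the total load, that is, three times the assigned rate. Phase II does not
undo any of this. -/

namespace VPCA.Network

variable {V F : Type*} [DecidableEq V] [Fintype F] [DecidableEq F]

open Finset

set_option linter.unusedSectionVars false

/-! ### The relaxed value as a minimum cut -/

/-- The capacity of the cut that separates the flows in `T` from the VNF-nodes on their paths. -/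
noncomputable def cut (N : Network V F) (T : Finset F) (U : Finset V) : ℝ :=
  ∑ f ∈ Tᶜ, N.rate f + ∑ v ∈ U, if ∃ f ∈ T, v ∈ N.path f then N.cap v else 0

/-- Weak duality: flows outside `T` are limited by their rates, flows in `T` by the capacities of
the nodes they can use. -/
theorem relaxedTraffic_le_cut (N : Network V F) {T : Finset F} {U : Finset V} {x : F → V → ℝ}
    (hx : x ∈ N.relaxedAssignments U) : N.relaxedTraffic U x ≤ N.cut T U := by
  obtain ⟨⟨h0, hcap, hsupp⟩, hrate⟩ := hx
  unfold relaxedTraffic cut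
  rw [← sum_compl_add_sum T]
  apply add_le_add
  · refine sum_le_sum fun f _ => le_trans ?_ (hrate f)
    exact sum_le_sum_of_subset_of_nonneg inter_subset_right fun v _ _ => h0 f v
  · have : ∀ f ∈ T, ∑ v ∈ N.nodesOn U f, x f v ≤
        ∑ v ∈ U, if ∃ g ∈ T, v ∈ N.path g then x f v else 0 := by
      intro f hf
      rw [← sum_filter]
      refine sum_le_sum_of_subset_of_nonneg ?_ fun v _ _ => h0 f v
      intro v hv
      simp only [nodesOn, mem_inter] at hv
      exact mem_filter.2 ⟨hv.2, f, hf, hv.1⟩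
    refine (sum_le_sum this).trans ?_
    rw [sum_comm]
    refine sum_le_sum fun v hv => ?_
    split_ifs
    · exact (sum_le_sum_of_subset_of_nonneg (subset_univ T) fun f _ _ => h0 f v).trans (hcap v hv)
    · simp

theorem zero_mem_relaxedAssignments (N : Network V F) (rate_nonneg : ∀ f, 0 ≤ N.rate f)
    (cap_nonneg : ∀ v, 0 ≤ N.cap v) (U : Finset V) : 0 ∈ N.relaxedAssignments U :=
  ⟨⟨fun _ _ => le_rfl, fun v _ => by simpa using cap_nonneg v, fun _ _ _ => rfl⟩,
    fun f => by simpa using rate_nonneg f⟩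

theorem isCompact_relaxedAssignments (N : Network V F) (rate_nonneg : ∀ f, 0 ≤ N.rate f)
    (U : Finset V) : IsCompact (N.relaxedAssignments U) := by
  have hsub : N.relaxedAssignments U ⊆ Set.Icc 0 fun f _ => N.rate f := by
    rintro x ⟨⟨h0, -, hsupp⟩, hrate⟩
    refine ⟨fun f v => h0 f v, fun f v => ?_⟩
    by_cases hv : v ∈ U
    · exact (single_le_sum (f := fun v => x f v) (fun v _ => h0 f v) hv).trans (hrate f)
    · rw [hsupp f v hv]; exact rate_nonneg f
  refine isCompact_Icc.of_isClosed_subset ?_ hsub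
  simp only [relaxedAssignments, CapacityFeasible, Set.ofPred_and, Set.ofPred_forall]
  refine IsClosed.inter (IsClosed.inter ?_ (IsClosed.inter ?_ ?_)) ?_
  · exact isClosed_iInter fun f => isClosed_iInter fun v =>
      isClosed_le (by fun_prop) (by fun_prop)
  · exact isClosed_iInter fun v => isClosed_iInter fun _ =>
      isClosed_le (by fun_prop) (by fun_prop)
  · exact isClosed_iInter fun f => isClosed_iInter fun v => isClosed_iInter fun _ =>
      isClosed_eq (by fun_prop) (by fun_prop)
  · exact isClosed_iInter fun f => isClosed_le (by fun_prop) (by fun_prop)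

/-- By compactness the supremum in `relaxedValue` is attained, so the `sSup` is a true maximum and
never a default value. -/
theorem exists_relaxedTraffic_eq (N : Network V F) (rate_nonneg : ∀ f, 0 ≤ N.rate f)
    (cap_nonneg : ∀ v, 0 ≤ N.cap v) (U : Finset V) :
    ∃ x ∈ N.relaxedAssignments U, N.relaxedTraffic U x = N.relaxedValue U ∧
      ∀ y ∈ N.relaxedAssignments U, N.relaxedTraffic U y ≤ N.relaxedValue U := by
  have hc : ContinuousOn (N.relaxedTraffic U) (N.relaxedAssignments U) := by
    unfold relaxedTraffic; fun_prop
  obtain ⟨x, hx, heq, hle⟩ :=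
    (N.isCompact_relaxedAssignments rate_nonneg U).exists_sSup_image_eq_and_ge
      ⟨0, N.zero_mem_relaxedAssignments rate_nonneg cap_nonneg U⟩ hc
  exact ⟨x, hx, heq.symm, fun y hy => (hle y hy).trans heq.ge⟩

theorem relaxedValue_le_cut (N : Network V F) (rate_nonneg : ∀ f, 0 ≤ N.rate f)
    (cap_nonneg : ∀ v, 0 ≤ N.cap v) (T : Finset F) (U : Finset V) :
    N.relaxedValue U ≤ N.cut T U := by
  obtain ⟨x, hx, heq, -⟩ := N.exists_relaxedTraffic_eq rate_nonneg cap_nonneg U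
  exact heq ▸ N.relaxedTraffic_le_cut hx

theorem sum_update_apply {x : F → V → ℝ} (f : F) (z : V → ℝ) (v : V) :
    ∑ g, Function.update x f z g v = ∑ g, x g v - x f v + z v := by
  have h1 := sum_erase_add univ (fun g => Function.update x f z g v) (mem_univ f)
  have h2 := sum_erase_add univ (fun g => x g v) (mem_univ f)
  have h3 : ∑ g ∈ univ.erase f, Function.update x f z g v = ∑ g ∈ univ.erase f, x g v :=
    sum_congr rfl fun g hg => by rw [Function.update_of_ne (ne_of_mem_erase hg)]
  simp only [Function.update_self] at h1
  linarith

theorem relaxedTraffic_update {x : F → V → ℝ} (N : Network V F) (U : Finset V) (f : F)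
    (z : V → ℝ) :
    N.relaxedTraffic U (Function.update x f z) =
      N.relaxedTraffic U x - ∑ v ∈ N.nodesOn U f, x f v + ∑ v ∈ N.nodesOn U f, z v := by
  unfold relaxedTraffic
  have h1 := sum_erase_add univ
    (fun g => ∑ v ∈ N.nodesOn U g, Function.update x f z g v) (mem_univ f)
  have h2 := sum_erase_add univ (fun g => ∑ v ∈ N.nodesOn U g, x g v) (mem_univ f)
  have h3 : ∑ g ∈ univ.erase f, ∑ v ∈ N.nodesOn U g, Function.update x f z g v =
      ∑ g ∈ univ.erase f, ∑ v ∈ N.nodesOn U g, x g v :=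
    sum_congr rfl fun g hg => by rw [Function.update_of_ne (ne_of_mem_erase hg)]
  simp only [Function.update_self] at h1
  linarith

/-! ### Strong duality, from an optimum with as many unsaturated flows as possible -/

/-- The optimal relaxed assignments that use only nodes on the paths of the flows. -/
def optimalOnPaths (N : Network V F) (U : Finset V) : Set (F → V → ℝ) :=
  {x | x ∈ N.relaxedAssignments U ∧ N.relaxedTraffic U x = N.relaxedValue U ∧
    ∀ f, ∀ v ∉ N.path f, x f v = 0}

theorem optimalOnPaths_nonempty (N : Network V F) (rate_nonneg : ∀ f, 0 ≤ N.rate f)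
    (cap_nonneg : ∀ v, 0 ≤ N.cap v) (U : Finset V) : (N.optimalOnPaths U).Nonempty := by
  obtain ⟨x, ⟨⟨h0, hcap, hsupp⟩, hrate⟩, heq, -⟩ :=
    N.exists_relaxedTraffic_eq rate_nonneg cap_nonneg U
  have hle : ∀ f v, (if v ∈ N.path f then x f v else 0) ≤ x f v := by
    intro f v; split_ifs <;> simp [h0]
  refine ⟨fun f v => if v ∈ N.path f then x f v else 0, ⟨⟨?_, ?_, ?_⟩, ?_⟩, ?_, ?_⟩
  · intro f v; dsimp only; split_ifs <;> simp [h0]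
  · exact fun v hv => (sum_le_sum fun f _ => hle f v).trans (hcap v hv)
  · intro f v hv; simp [hsupp f v hv]
  · exact fun f => (sum_le_sum fun v _ => hle f v).trans (hrate f)
  · rw [← heq]
    refine sum_congr rfl fun f _ => sum_congr rfl fun v hv => ?_
    simp only [nodesOn, mem_inter] at hv
    simp [hv.1]
  · intro f v hv; simp [hv]

theorem midpoint_mem_optimalOnPaths (N : Network V F) {U : Finset V} {x y : F → V → ℝ}
    (hx : x ∈ N.optimalOnPaths U) (hy : y ∈ N.optimalOnPaths U) :
    (fun f v => (x f v + y f v) / 2) ∈ N.optimalOnPaths U := by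
  obtain ⟨⟨⟨hx0, hxcap, hxs⟩, hxr⟩, hxeq, hxp⟩ := hx
  obtain ⟨⟨⟨hy0, hycap, hys⟩, hyr⟩, hyeq, hyp⟩ := hy
  refine ⟨⟨⟨?_, ?_, ?_⟩, ?_⟩, ?_, ?_⟩
  · intro f v; linarith [hx0 f v, hy0 f v]
  · intro v hv
    rw [← sum_div, sum_add_distrib]; linarith [hxcap v hv, hycap v hv]
  · intro f v hv; simp [hxs f v hv, hys f v hv]
  · intro f
    rw [← sum_div, sum_add_distrib]; linarith [hxr f, hyr f]
  · unfold relaxedTraffic at *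
    simp_rw [← sum_div, sum_add_distrib]; linarith
  · intro f v hv; simp [hxp f v hv, hyp f v hv]

/-- The flows that are not processed completely by the assignment `x`. -/
noncomputable def unsaturated (N : Network V F) (U : Finset V) (x : F → V → ℝ) : Finset F :=
  univ.filter fun f => ∑ v ∈ U, x f v < N.rate f

/-- A flow unsaturated in one of two optima is unsaturated in their midpoint, which is again
optimal. Hence an optimum with the most unsaturated flows dominates all others. -/
theorem exists_maximal_unsaturated (N : Network V F) (rate_nonneg : ∀ f, 0 ≤ N.rate f)
    (cap_nonneg : ∀ v, 0 ≤ N.cap v) (U : Finset V) :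
    ∃ x ∈ N.optimalOnPaths U, ∀ y ∈ N.optimalOnPaths U,
      N.unsaturated U y ⊆ N.unsaturated U x := by
  obtain ⟨T, ⟨x, hx, rfl⟩, hmax⟩ := Set.exists_max_image (N.unsaturated U '' N.optimalOnPaths U)
    card (Set.toFinite _) ((N.optimalOnPaths_nonempty rate_nonneg cap_nonneg U).image _)
  refine ⟨x, hx, fun y hy => ?_⟩
  set w : F → V → ℝ := fun f v => (x f v + y f v) / 2
  have hw : w ∈ N.optimalOnPaths U := N.midpoint_mem_optimalOnPaths hx hy
  have hsum : ∀ f, ∑ v ∈ U, w f v = (∑ v ∈ U, x f v + ∑ v ∈ U, y f v) / 2 := fun f => by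
    rw [← sum_add_distrib, sum_div]
  have hxw : N.unsaturated U x ⊆ N.unsaturated U w := fun f hf => by
    simp only [unsaturated, mem_filter, mem_univ, true_and, hsum] at hf ⊢
    linarith [hy.1.2 f]
  have hyw : N.unsaturated U y ⊆ N.unsaturated U w := fun f hf => by
    simp only [unsaturated, mem_filter, mem_univ, true_and, hsum] at hf ⊢
    linarith [hx.1.2 f]
  rw [eq_of_subset_of_card_le hxw (hmax _ ⟨w, hw, rfl⟩)]
  exact hyw

theorem sum_add_single {U : Finset V} {v : V} (hv : v ∈ U) (z : V → ℝ) (t : ℝ) :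
    ∑ w ∈ U, (z + Pi.single v t : V → ℝ) w = ∑ w ∈ U, z w + t := by
  simp [sum_add_distrib, hv]

/-- The amount `t` may be negative, so the lemma serves both to withdraw traffic and to add it. -/
theorem add_single_mem_relaxedAssignments (N : Network V F) {U : Finset V} {x : F → V → ℝ}
    (hx : x ∈ N.relaxedAssignments U) {f : F} {v : V} (hv : v ∈ U) {t : ℝ} (ht : 0 ≤ x f v + t)
    (hf : ∑ w ∈ U, x f w + t ≤ N.rate f) (hcap : ∑ g, x g v + t ≤ N.cap v) :
    Function.update x f (x f + Pi.single v t) ∈ N.relaxedAssignments U := by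
  obtain ⟨⟨h0, hc, hs⟩, hr⟩ := hx
  refine ⟨⟨?_, ?_, ?_⟩, ?_⟩
  · intro g w
    by_cases hg : g = f
    · subst hg
      by_cases hw : w = v
      · subst hw; simpa using ht
      · simpa [hw] using h0 g w
    · simpa [hg] using h0 g w
  · intro w hw
    rw [sum_update_apply]
    by_cases hwv : w = v
    · subst hwv
      simp only [Pi.add_apply, Pi.single_eq_same]
      linarith
    · simpa [hwv] using hc w hw
  · intro g w hw
    have hwv : w ≠ v := fun h => hw (h ▸ hv)
    by_cases hg : g = f
    · subst hg; simp [hwv, hs g w hw]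
    · simp [hg, hs g w hw]
  · intro g
    by_cases hg : g = f
    · subst hg
      rw [Function.update_self, sum_add_single hv]; exact hf
    · simpa [hg] using hr g

theorem relaxedTraffic_add_single (N : Network V F) {U : Finset V} (x : F → V → ℝ)
    {f : F} {v : V} (hv : v ∈ N.nodesOn U f) (t : ℝ) :
    N.relaxedTraffic U (Function.update x f (x f + Pi.single v t)) =
      N.relaxedTraffic U x + t := by
  rw [relaxedTraffic_update, sum_add_single hv]; ring

/-- The cut is the maximal set of unsaturated flows. Their nodes are full and serve no saturated
flow, so weak duality is tight; this replaces augmenting paths. -/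
theorem exists_relaxedValue_eq_cut (N : Network V F) (rate_nonneg : ∀ f, 0 ≤ N.rate f)
    (cap_nonneg : ∀ v, 0 ≤ N.cap v) (U : Finset V) :
    ∃ T : Finset F, N.relaxedValue U = N.cut T U := by
  obtain ⟨x, hx, hmax⟩ := N.exists_maximal_unsaturated rate_nonneg cap_nonneg U
  obtain ⟨-, -, -, hopt⟩ := N.exists_relaxedTraffic_eq rate_nonneg cap_nonneg U
  have hxR := hx.1
  obtain ⟨⟨⟨h0, hc, hs⟩, hr⟩, heq, hp⟩ := hx
  set T := N.unsaturated U x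
  have hT : ∀ f, f ∈ T ↔ ∑ v ∈ U, x f v < N.rate f := fun f => by simp [T, unsaturated]
  -- Spare capacity at `v` would let `f` gain traffic, against optimality.
  have hsat : ∀ f ∈ T, ∀ v ∈ N.nodesOn U f, ∑ g, x g v = N.cap v := by
    intro f hf v hv
    have hvU : v ∈ U := (mem_inter.1 hv).2
    by_contra hne
    have hlt : ∑ g, x g v < N.cap v := lt_of_le_of_ne (hc v hvU) hne
    set t := min (N.cap v - ∑ g, x g v) (N.rate f - ∑ w ∈ U, x f w)
    have ht : 0 < t := lt_min (sub_pos.2 hlt) (sub_pos.2 ((hT f).1 hf))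
    have h1 : t ≤ N.cap v - ∑ g, x g v := min_le_left _ _
    have h2 : t ≤ N.rate f - ∑ w ∈ U, x f w := min_le_right _ _
    have := hopt _ (N.add_single_mem_relaxedAssignments hxR hvU
      (add_nonneg (h0 f v) ht.le) (by linarith) (by linarith))
    rw [N.relaxedTraffic_add_single x hv] at this
    linarith
  -- Shifting a little of the share of `g` at `v` to `f` keeps the value optimal but makes `g`
  -- unsaturated, so maximality would put `g` in `T`.
  have hzero : ∀ f ∈ T, ∀ v ∈ N.nodesOn U f, ∀ g ∉ T, x g v = 0 := by
    intro f hf v hv g hg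
    have hvU : v ∈ U := (mem_inter.1 hv).2
    have hfg : f ≠ g := fun h => hg (h ▸ hf)
    by_contra hne
    have hpos : 0 < x g v := lt_of_le_of_ne (h0 g v) (Ne.symm hne)
    have hvg : v ∈ N.nodesOn U g := by
      refine mem_inter.2 ⟨?_, hvU⟩
      by_contra h; exact hne (hp g v h)
    set t := min (x g v) (N.rate f - ∑ w ∈ U, x f w)
    have ht : 0 < t := lt_min hpos (sub_pos.2 ((hT f).1 hf))
    have h1 : t ≤ x g v := min_le_left _ _
    have h2 : t ≤ N.rate f - ∑ w ∈ U, x f w := min_le_right _ _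
    set y := Function.update x g (x g + Pi.single v (-t)) with hy
    have hyR : y ∈ N.relaxedAssignments U :=
      N.add_single_mem_relaxedAssignments hxR hvU (by linarith) (by linarith [hr g])
        (by linarith [hc v hvU])
    have hyf : y f = x f := Function.update_of_ne hfg _ _
    have hysum : ∑ g', y g' v = ∑ g', x g' v - t := by
      rw [hy, sum_update_apply]; simp; ring
    set z := Function.update y f (y f + Pi.single v t) with hz
    have hzR : z ∈ N.relaxedAssignments U := by
      refine N.add_single_mem_relaxedAssignments hyR hvU ?_ ?_ ?_
      · rw [hyf]; linarith [h0 f v]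
      · rw [hyf]; linarith
      · rw [hysum]; linarith [hc v hvU]
    have hzg : z g = x g + Pi.single v (-t) := by
      rw [hz, Function.update_of_ne hfg.symm, hy, Function.update_self]
    have hzopt : z ∈ N.optimalOnPaths U := by
      refine ⟨hzR, ?_, ?_⟩
      · rw [hz, N.relaxedTraffic_add_single y hv, hy, N.relaxedTraffic_add_single x hvg, heq]
        ring
      · intro f' w hw
        by_cases hf' : f' = f
        · subst hf'
          have : w ≠ v := fun h => hw (h ▸ (mem_inter.1 hv).1)
          simp [hz, hyf, this, hp f' w hw]
        · by_cases hg' : f' = g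
          · subst hg'
            have : w ≠ v := fun h => hw (h ▸ (mem_inter.1 hvg).1)
            simp [hzg, this, hp f' w hw]
          · simp [hz, hy, hf', hg', hp f' w hw]
    apply hg
    apply hmax z hzopt
    simp only [unsaturated, mem_filter, mem_univ, true_and]
    rw [hzg, sum_add_single hvU]
    linarith [hr g]
  refine ⟨T, ?_⟩
  rw [← heq]
  unfold relaxedTraffic cut
  rw [← sum_compl_add_sum T]
  have hnodes : ∀ f, ∑ v ∈ N.nodesOn U f, x f v = ∑ v ∈ U, x f v := fun f => by
    refine sum_subset inter_subset_right fun v hv hv' => hp f v fun h => ?_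
    exact hv' (mem_inter.2 ⟨h, hv⟩)
  congr 1
  · refine sum_congr rfl fun f hf => ?_
    rw [hnodes]
    exact le_antisymm (hr f) (not_lt.1 fun h => mem_compl.1 hf ((hT f).2 h))
  · simp_rw [hnodes]
    rw [sum_comm]
    refine sum_congr rfl fun v hv => ?_
    split_ifs with h
    · obtain ⟨f, hf, hfv⟩ := h
      have hvf : v ∈ N.nodesOn U f := mem_inter.2 ⟨hfv, hv⟩
      rw [← hsat f hf v hvf]
      exact sum_subset (subset_univ T) fun g _ hg => hzero f hf v hvf g hg
    · exact sum_eq_zero fun f hf => hp f v fun hfv => h ⟨f, hf, hfv⟩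

/-! ### Monotonicity and submodularity of the relaxed value -/

theorem relaxedValue_mono (N : Network V F) (rate_nonneg : ∀ f, 0 ≤ N.rate f)
    (cap_nonneg : ∀ v, 0 ≤ N.cap v) : Monotone N.relaxedValue := by
  intro S U hSU
  obtain ⟨T, hT⟩ := N.exists_relaxedValue_eq_cut rate_nonneg cap_nonneg U
  rw [hT]
  refine (N.relaxedValue_le_cut rate_nonneg cap_nonneg T S).trans (add_le_add le_rfl ?_)
  refine sum_le_sum_of_subset_of_nonneg hSU fun v _ _ => ?_
  split_ifs
  exacts [cap_nonneg v, le_rfl]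

theorem relaxedValue_empty (N : Network V F) (rate_nonneg : ∀ f, 0 ≤ N.rate f)
    (cap_nonneg : ∀ v, 0 ≤ N.cap v) : N.relaxedValue ∅ = 0 := by
  obtain ⟨x, -, hx, -⟩ := N.exists_relaxedTraffic_eq rate_nonneg cap_nonneg ∅
  rw [← hx]
  simp [relaxedTraffic, nodesOn]

/-- The contribution of one node to the uncrossing of cuts: `s`, `t` stand for membership in the two
node sets, `a`, `b` for lying on a path of either flow set. For `p` there is only an implication,
since a node on paths of both sets need not be on the path of a common flow. -/
theorem ite_add_ite_le {s t i j a b p q : Prop} [Decidable s] [Decidable t] [Decidable i]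
    [Decidable j] [Decidable a] [Decidable b] [Decidable p] [Decidable q] {c : ℝ} (hc : 0 ≤ c)
    (hi : i ↔ s ∨ t) (hj : j ↔ s ∧ t) (hp : p → a ∧ b) (hq : q → a ∨ b) :
    ((if i then if p then c else 0 else 0) + if j then if q then c else 0 else 0) ≤
      (if s then if a then c else 0 else 0) + if t then if b then c else 0 else 0 := by
  by_cases hs : s <;> by_cases ht : t <;> by_cases ha : a <;> by_cases hb : b <;>
    simp only [hs, ht, ha, hb, or_self, or_true, true_or, and_self, and_true, and_false,
      iff_true, iff_false, imp_false] at hi hj hp hq <;>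
    simp only [hs, ht, ha, hb, hi, hj, hp, hq, if_true, if_false] <;>
    (try split_ifs) <;> linarith

/-- Uncrossing minimum cuts `A` of `S` and `B` of `U`: the union is tested against `A ∩ B`, the
intersection against `A ∪ B`. The rate terms balance exactly, the capacity terms node by node. -/
theorem relaxedValue_union_add_inter_le (N : Network V F) (rate_nonneg : ∀ f, 0 ≤ N.rate f)
    (cap_nonneg : ∀ v, 0 ≤ N.cap v) (S U : Finset V) :
    N.relaxedValue (S ∪ U) + N.relaxedValue (S ∩ U) ≤ N.relaxedValue S + N.relaxedValue U := by
  obtain ⟨A, hA⟩ := N.exists_relaxedValue_eq_cut rate_nonneg cap_nonneg S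
  obtain ⟨B, hB⟩ := N.exists_relaxedValue_eq_cut rate_nonneg cap_nonneg U
  have h1 := N.relaxedValue_le_cut rate_nonneg cap_nonneg (A ∩ B) (S ∪ U)
  have h2 := N.relaxedValue_le_cut rate_nonneg cap_nonneg (A ∪ B) (S ∩ U)
  have hrate : ∑ f ∈ (A ∩ B)ᶜ, N.rate f + ∑ f ∈ (A ∪ B)ᶜ, N.rate f =
      ∑ f ∈ Aᶜ, N.rate f + ∑ f ∈ Bᶜ, N.rate f := by
    rw [compl_inter, compl_union]; exact sum_union_inter
  have hcap : (∑ v ∈ S ∪ U, if ∃ f ∈ A ∩ B, v ∈ N.path f then N.cap v else 0) +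
      (∑ v ∈ S ∩ U, if ∃ f ∈ A ∪ B, v ∈ N.path f then N.cap v else 0) ≤
      (∑ v ∈ S, if ∃ f ∈ A, v ∈ N.path f then N.cap v else 0) +
      ∑ v ∈ U, if ∃ f ∈ B, v ∈ N.path f then N.cap v else 0 := by
    let W := S ∪ U
    have hW : ∀ (X : Finset V) (g : V → ℝ), X ⊆ W →
        ∑ v ∈ X, g v = ∑ v ∈ W, if v ∈ X then g v else 0 := fun X g hX => by
      rw [sum_ite_mem, inter_eq_right.2 hX]
    rw [hW _ _ subset_rfl, hW (S ∩ U) _ (inter_subset_left.trans subset_union_left),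
      hW S _ subset_union_left, hW U _ subset_union_right, ← sum_add_distrib, ← sum_add_distrib]
    refine sum_le_sum fun v _ => ?_
    exact ite_add_ite_le (cap_nonneg v) mem_union mem_inter
      (fun ⟨f, hf, hv⟩ => ⟨⟨f, (mem_inter.1 hf).1, hv⟩, ⟨f, (mem_inter.1 hf).2, hv⟩⟩)
      (fun ⟨f, hf, hv⟩ => (mem_union.1 hf).imp (fun h => ⟨f, h, hv⟩) (fun h => ⟨f, h, hv⟩))
  unfold cut at *
  linarith

/-- Fully processing a set of flows is at most as good as the relaxed optimum. -/
theorem fullyProcessed_le_relaxedValue (N : Network V F) (rate_nonneg : ∀ f, 0 ≤ N.rate f)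
    (cap_nonneg : ∀ v, 0 ≤ N.cap v) {U : Finset V} {x : F → V → ℝ}
    (hx : N.CapacityFeasible U x) : N.fullyProcessed U x ≤ N.relaxedValue U := by
  -- A VPCA assignment may exceed the rates, so it need not be a relaxed one; it is compared with a
  -- minimum cut directly.
  obtain ⟨T, hT⟩ := N.exists_relaxedValue_eq_cut rate_nonneg cap_nonneg U
  obtain ⟨h0, hc, hs⟩ := hx
  rw [hT]
  unfold fullyProcessed cut
  rw [← sum_compl_add_sum T]
  apply add_le_add
  · refine sum_le_sum fun f _ => ?_
    split_ifs
    exacts [le_rfl, rate_nonneg f]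
  · have : ∀ f ∈ T, (if N.rate f ≤ ∑ v ∈ N.nodesOn U f, x f v then N.rate f else 0) ≤
        ∑ v ∈ U, if ∃ g ∈ T, v ∈ N.path g then x f v else 0 := by
      intro f hf
      have hle : ∑ v ∈ N.nodesOn U f, x f v ≤
          ∑ v ∈ U, if ∃ g ∈ T, v ∈ N.path g then x f v else 0 := by
        rw [← sum_filter]
        refine sum_le_sum_of_subset_of_nonneg ?_ fun v _ _ => h0 f v
        intro v hv
        simp only [nodesOn, mem_inter] at hv
        exact mem_filter.2 ⟨hv.2, f, hf, hv.1⟩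
      split_ifs with h
      · exact h.trans hle
      · exact (sum_nonneg fun v _ => h0 f v).trans hle
    refine (sum_le_sum this).trans ?_
    rw [sum_comm]
    refine sum_le_sum fun v hv => ?_
    split_ifs
    · exact (sum_le_sum_of_subset_of_nonneg (subset_univ T) fun f _ _ => h0 f v).trans (hc v hv)
    · simp

end VPCA.Network

namespace VPCA

open Finset

set_option linter.unusedSectionVars false

/-! ### Greedy maximization of monotone submodular functions -/

section Submodular

variable {V : Type*} [DecidableEq V] {f : Finset V → ℝ}

theorem marginal_anti (mono : Monotone f) (submod : ∀ S T, f (S ∪ T) + f (S ∩ T) ≤ f S + f T)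
    {S T : Finset V} (hST : S ⊆ T) (u : V) :
    f (insert u T) - f T ≤ f (insert u S) - f S := by
  by_cases hu : u ∈ T
  · rw [insert_eq_of_mem hu]
    linarith [mono (subset_insert u S)]
  · have h := submod (insert u S) T
    have h1 : insert u S ∪ T = insert u T := by
      rw [insert_union, union_eq_right.2 hST]
    have h2 : insert u S ∩ T = S := by
      rw [insert_inter_of_notMem hu, inter_eq_left.2 hST]
    rw [h1, h2] at h
    linarith

/-- Add the elements of `O \ S` to `S` one by one; by submodularity each gains at most its marginal
value at `S`. -/
theorem le_add_sum_marginals (mono : Monotone f)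
    (submod : ∀ S T, f (S ∪ T) + f (S ∩ T) ≤ f S + f T) (S O : Finset V) :
    f O ≤ f S + ∑ o ∈ O \ S, (f (insert o S) - f S) := by
  have key : ∀ D : Finset V, f (S ∪ D) ≤ f S + ∑ o ∈ D, (f (insert o S) - f S) := by
    intro D
    induction D using Finset.induction_on with
    | empty => simp
    | insert a D ha ih =>
      rw [sum_insert ha, union_insert]
      linarith [marginal_anti mono submod (subset_union_left : S ⊆ S ∪ D) a]
  refine le_trans (mono ?_) (key (O \ S))
  rw [union_sdiff_self_eq_union]
  exact subset_union_right

theorem exp_neg_one_mul_le {D₀ D : ℝ} (h0 : 0 ≤ D₀) {s : ℝ} (hs : 1 ≤ s)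
    (h : D ≤ Real.exp (-s) * D₀) : D ≤ 1 / Real.exp 1 * D₀ := by
  rw [one_div, ← Real.exp_neg]
  exact h.trans (mul_le_mul_of_nonneg_right (Real.exp_le_exp.2 (by linarith)) h0)

/-- One greedy step that gains at least the fraction `t` of the remaining deficit `D`. -/
theorem deficit_step {D₀ D D' s t : ℝ} (h0 : 0 ≤ D₀) (hD : D ≤ Real.exp (-s) * D₀)
    (hmono : D' ≤ D) (hstep : t * D ≤ D - D') : D' ≤ Real.exp (-(s + t)) * D₀ := by
  rcases le_total D 0 with h | h
  · exact (hmono.trans h).trans (by positivity)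
  -- The deficit shrinks by the factor $1-t\le e^{-t}$.
  · have h1 : D' ≤ Real.exp (-t) * D := by
      have := Real.add_one_le_exp (-t)
      nlinarith
    rw [neg_add, add_comm, Real.exp_add, mul_assoc]
    exact h1.trans (mul_le_mul_of_nonneg_left hD (Real.exp_pos _).le)

/-- Three elements of `O`, chosen greedily: every other element of `O` has a small marginal value
with respect to all supersets. -/
theorem exists_greedy_triple (mono : Monotone f)
    (submod : ∀ S T, f (S ∪ T) + f (S ∩ T) ≤ f S + f T) (hempty : f ∅ = 0) {O : Finset V}
    (hO : 3 ≤ O.card) :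
    ∃ Y ⊆ O, Y.card = 3 ∧ ∀ S, Y ⊆ S → ∀ o ∈ O \ Y, f (insert o S) - f S ≤ f Y / 3 := by
  have pick : ∀ Z ⊆ O, Z.card < 3 → ∃ a ∈ O \ Z, ∀ o ∈ O \ Z, f (insert o Z) ≤ f (insert a Z) := by
    intro Z hZ hc
    apply exists_max_image
    rw [← card_pos, card_sdiff_of_subset hZ]
    omega
  obtain ⟨a, ha, hamax⟩ := pick ∅ (empty_subset _) (by simp)
  have hA : ({a} : Finset V) ⊆ O := singleton_subset_iff.2 (mem_sdiff.1 ha).1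
  obtain ⟨b, hb, hbmax⟩ := pick {a} hA (by simp)
  rw [mem_sdiff, mem_singleton] at hb
  have hB : ({b, a} : Finset V) ⊆ O := insert_subset hb.1 hA
  have hBc : ({b, a} : Finset V).card = 2 := card_pair hb.2
  obtain ⟨c, hc, hcmax⟩ := pick {b, a} hB (by omega)
  rw [mem_sdiff] at hc
  refine ⟨{c, b, a}, insert_subset hc.1 hB, by rw [card_insert_of_notMem hc.2, hBc], ?_⟩
  intro S hS o ho
  rw [mem_sdiff, mem_insert, not_or] at ho
  have hBS : ({b, a} : Finset V) ⊆ S := (subset_insert _ _).trans hS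
  have hAS : ({a} : Finset V) ⊆ S := (subset_insert _ _).trans hBS
  -- The gain of `o` at `S` is at most each of the gains of `a`, `b`, `c` when they were picked;
  -- these three sum to `f Y`.
  have h1 := marginal_anti mono submod (empty_subset S) o
  have h2 := marginal_anti mono submod hAS o
  have h3 := marginal_anti mono submod hBS o
  have g1 := hamax o (by simp [ho.1])
  have g2 := hbmax o (mem_sdiff.2 ⟨ho.1, fun h => ho.2.2 (mem_insert_of_mem h)⟩)
  have g3 := hcmax o (mem_sdiff.2 ⟨ho.1, ho.2.2⟩)
  simp only [insert_empty_eq] at h1 g1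
  linarith

end Submodular

namespace Network

/-! ### Approximation guarantees of the placement algorithms -/

variable {V F : Type*} [DecidableEq V] [Fintype F]

theorem GreedyRun.card_eq {N : Network V F} {n : ℕ} {U : Finset V} (h : N.GreedyRun n U) :
    U.card = n := by
  induction h with
  | zero => rfl
  | succ run hu best ih => rw [card_insert_of_notMem hu, ih]

/-- At most `k` elements of `O` are missing and together they cover the deficit, so the best node
gains at least a `1 / k` share of it. -/
theorem GreedyRun.deficit_le {N : Network V F} (mono : Monotone N.relaxedValue)
    (submod : ∀ S T, N.relaxedValue (S ∪ T) + N.relaxedValue (S ∩ T) ≤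
      N.relaxedValue S + N.relaxedValue T) {O : Finset V}
    {k : ℕ} (hO : O.card ≤ k) (hk : 0 < k) (h0 : N.relaxedValue ∅ = 0)
    {n : ℕ} {U : Finset V} (h : N.GreedyRun n U) :
    N.relaxedValue O - N.relaxedValue U ≤ Real.exp (-(n / k : ℝ)) * N.relaxedValue O := by
  have hkR : (0 : ℝ) < k := by exact_mod_cast hk
  have hOnn : 0 ≤ N.relaxedValue O := h0 ▸ mono (empty_subset O)
  induction h with
  | zero => simp [h0]
  | @succ n U u run hu best ih =>
    have hgain : 0 ≤ N.relaxedValue (insert u U) - N.relaxedValue U :=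
      sub_nonneg.2 (mono (subset_insert u U))
    have hsum : ∑ o ∈ O \ U, (N.relaxedValue (insert o U) - N.relaxedValue U) ≤
        k * (N.relaxedValue (insert u U) - N.relaxedValue U) := by
      refine (sum_le_card_nsmul _ _ _ fun o ho => best o (mem_sdiff.1 ho).2).trans ?_
      rw [nsmul_eq_mul]
      refine mul_le_mul_of_nonneg_right ?_ hgain
      exact_mod_cast (card_le_card sdiff_subset).trans hO
    have hle := le_add_sum_marginals mono submod U O
    have := deficit_step (t := 1 / k) (D' := N.relaxedValue O - N.relaxedValue (insert u U))
      hOnn ih (by linarith) (by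
        rw [div_mul_eq_mul_div, one_mul, div_le_iff₀ hkR]; linarith)
    convert this using 3
    push_cast
    ring

theorem IsSubmodularGreedy.le_relaxedValue [Fintype V] {N : Network V F}
    (mono : Monotone N.relaxedValue)
    (submod : ∀ S T, N.relaxedValue (S ∪ T) + N.relaxedValue (S ∩ T) ≤
      N.relaxedValue S + N.relaxedValue T) (h0 : N.relaxedValue ∅ = 0)
    {U O : Finset V} (h : N.IsSubmodularGreedy U) (hO : N.Affordable O) :
    (1 - 1 / Real.exp 1) * N.relaxedValue O ≤ N.relaxedValue U := by
  obtain ⟨b, hb, hcost, run⟩ := h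
  have hcard : O.card ≤ min ⌊N.budget / b⌋₊ (Fintype.card V) := by
    refine le_min (Nat.le_floor ?_) (card_le_univ O)
    rw [le_div_iff₀ hb]
    simpa [Affordable, hcost] using hO
  have hOnn : 0 ≤ N.relaxedValue O := h0 ▸ mono (empty_subset O)
  rcases Nat.eq_zero_or_pos (min ⌊N.budget / b⌋₊ (Fintype.card V)) with hk | hk
  · have : O = ∅ := card_eq_zero.1 (by omega)
    subst this
    rw [h0, mul_zero, ← h0]
    exact mono (empty_subset U)
  · have hd := run.deficit_le mono submod hcard hk h0
    rw [div_self (by exact_mod_cast hk.ne')] at hd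
    have := exp_neg_one_mul_le hOnn le_rfl hd
    linarith

theorem IsSubmodularGreedy.affordable [Fintype V] {N : Network V F}
    (budget_nonneg : 0 ≤ N.budget) {U : Finset V} (h : N.IsSubmodularGreedy U) :
    N.Affordable U := by
  obtain ⟨b, hb, hcost, run⟩ := h
  have h1 : (U.card : ℝ) ≤ N.budget / b := by
    refine le_trans ?_ (Nat.floor_le (div_nonneg budget_nonneg hb.le))
    exact_mod_cast run.card_eq ▸ min_le_left _ _
  rw [le_div_iff₀ hb] at h1
  simpa [Affordable, hcost] using h1

/-- Greedy augmentation of a good three-element subset of `O` is a `(1 - 1/e)`-approximation. -/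
theorem le_relaxedValue_of_greedilyAugments {N : Network V F} (mono : Monotone N.relaxedValue)
    (submod : ∀ S T, N.relaxedValue (S ∪ T) + N.relaxedValue (S ∩ T) ≤
      N.relaxedValue S + N.relaxedValue T) (h0 : N.relaxedValue ∅ = 0)
    (cost_pos : ∀ v, 0 < N.cost v) {O Y T : Finset V} (hO : N.Affordable O) (hYO : Y ⊆ O)
    (hY : ∀ S, Y ⊆ S → ∀ o ∈ O \ Y,
      N.relaxedValue (insert o S) - N.relaxedValue S ≤ N.relaxedValue Y / 3)
    (h : N.GreedilyAugments Y T) :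
    (1 - 1 / Real.exp 1) * N.relaxedValue O ≤ N.relaxedValue T := by
  obtain ⟨hsteps, hmax⟩ := h
  set f := N.relaxedValue with hf
  have hYnn : 0 ≤ f Y := h0 ▸ mono (empty_subset Y)
  have hD0 : 0 ≤ f O - f Y := sub_nonneg.2 (mono hYO)
  -- This is why triples suffice: the loss `f Y / 3` from one node that does not fit is covered by
  -- the surplus `f Y / e`.
  have he3 : 1 / 3 ≤ 1 / Real.exp 1 :=
    one_div_le_one_div_of_le (Real.exp_pos 1) (Real.exp_one_lt_d9.le.trans (by norm_num))
  have hpos : 0 < 1 / Real.exp 1 := by positivity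
  set c := ∑ v ∈ O \ Y, N.cost v with hc
  have hcO : ∀ {S}, Y ⊆ S → ¬ O ⊆ S → 0 < c := fun hYS hOS =>
    sum_pos (fun v _ => cost_pos v)
      (sdiff_nonempty.2 fun h => hOS (h.trans hYS))
  -- The deficit decays like $e^{-\text{spent}/c}$. Affordability of `u` is not required, so the
  -- step also applies to a hypothetical addition beyond the budget.
  have step : ∀ S u, Y ⊆ S → ¬ O ⊆ S → u ∉ S →
      (∀ w ∈ O \ S, N.relativeGain S w ≤ N.relativeGain S u) →
      f O - f S ≤ Real.exp (-((∑ v ∈ S \ Y, N.cost v) / c)) * (f O - f Y) →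
      f O - f (insert u S) ≤
        Real.exp (-((∑ v ∈ insert u S \ Y, N.cost v) / c)) * (f O - f Y) := by
    intro S u hYS hOS hu hbest hinv
    have hcpos := hcO hYS hOS
    have hgain : ∀ w, N.relativeGain S w * N.cost w = f (insert w S) - f S := fun w =>
      div_mul_cancel₀ _ (cost_pos w).ne'
    have hrnn : 0 ≤ N.relativeGain S u :=
      div_nonneg (sub_nonneg.2 (mono (subset_insert u S))) (cost_pos u).le
    have hsum : f O - f S ≤ N.relativeGain S u * c := by
      have h1 := le_add_sum_marginals mono submod S O
      have h2 : ∑ o ∈ O \ S, (f (insert o S) - f S) ≤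
          ∑ o ∈ O \ S, N.relativeGain S u * N.cost o :=
        sum_le_sum fun o ho => by
          rw [← hgain]
          exact mul_le_mul_of_nonneg_right (hbest o ho) (cost_pos o).le
      rw [← mul_sum] at h2
      have h3 : ∑ o ∈ O \ S, N.cost o ≤ c :=
        sum_le_sum_of_subset_of_nonneg (sdiff_subset_sdiff subset_rfl hYS)
          fun v _ _ => (cost_pos v).le
      linarith [mul_le_mul_of_nonneg_left h3 hrnn]
    have hs : (∑ v ∈ insert u S \ Y, N.cost v) / c =
        (∑ v ∈ S \ Y, N.cost v) / c + N.cost u / c := by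
      rw [insert_sdiff_of_notMem _ fun h => hu (hYS h),
        sum_insert fun h => hu (mem_sdiff.1 h).1, add_div, add_comm]
    rw [hs]
    refine deficit_step hD0 hinv (sub_le_sub_left (mono (subset_insert u S)) _) ?_
    have h4 := mul_le_mul_of_nonneg_left hsum (div_nonneg (cost_pos u).le hcpos.le)
    have h5 : N.cost u / c * (N.relativeGain S u * c) = N.relativeGain S u * N.cost u := by
      field_simp
    rw [h5, hgain] at h4
    linarith
  -- If the best missing `o` of `O` fits, greedy does at least as well as `o`. Otherwise adding `o`
  -- anyway overspends the budget and brings the deficit down to a `1/e` fraction; dropping `o`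
  -- again loses at most `f Y / 3`.
  have dichotomy : ∀ S, Y ⊆ S → f S ≤ f T →
      f O - f S ≤ Real.exp (-((∑ v ∈ S \ Y, N.cost v) / c)) * (f O - f Y) →
      (1 - 1 / Real.exp 1) * f O ≤ f T ∨ ¬ O ⊆ S ∧
        ∃ o, N.CanAdd S o ∧ ∀ w ∈ O \ S, N.relativeGain S w ≤ N.relativeGain S o := by
    intro S hYS hST hinv
    by_cases hOS : O ⊆ S
    · left
      have := mono hOS
      have := mul_nonneg hpos.le (h0 ▸ mono (empty_subset O) : 0 ≤ f O)
      linarith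
    obtain ⟨o, ho, hbest⟩ := exists_max_image (O \ S) (N.relativeGain S) (sdiff_nonempty.2 hOS)
    have hoS := (mem_sdiff.1 ho).2
    by_cases hadd : N.Affordable (insert o S)
    · exact Or.inr ⟨hOS, o, ⟨hoS, hadd⟩, hbest⟩
    left
    -- `insert o S` exceeds the budget and `O` does not; subtract the cost of `Y` from both.
    have hlarge : 1 ≤ (∑ v ∈ insert o S \ Y, N.cost v) / c := by
      rw [one_le_div (hcO hYS hOS), hc]
      have h1 := sum_sdiff (f := N.cost) hYO
      have h2 := sum_sdiff (f := N.cost) (hYS.trans (subset_insert o S))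
      unfold Affordable at hadd hO
      linarith
    have h1 := exp_neg_one_mul_le hD0 hlarge (step S o hYS hOS hoS hbest hinv)
    have h2 := hY S hYS o (mem_sdiff.2 ⟨(mem_sdiff.1 ho).1, fun h => hoS (hYS h)⟩)
    have h3 := mul_nonneg (sub_nonneg.2 he3) hYnn
    linarith
  have hle : ∀ {S}, Relation.ReflTransGen N.AugmentStep S T → f S ≤ f T := by
    intro S hST
    induction hST using Relation.ReflTransGen.head_induction_on with
    | refl => exact le_rfl
    | head hstep _ ih =>
      obtain ⟨u, -, -, rfl⟩ := hstep
      exact (mono (subset_insert _ _)).trans ih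
  have key : ∀ S, Relation.ReflTransGen N.AugmentStep S T → Y ⊆ S →
      f O - f S ≤ Real.exp (-((∑ v ∈ S \ Y, N.cost v) / c)) * (f O - f Y) →
      (1 - 1 / Real.exp 1) * f O ≤ f T := by
    intro S hST
    induction hST using Relation.ReflTransGen.head_induction_on with
    | refl =>
      intro hYS hinv
      rcases dichotomy T hYS le_rfl hinv with h | ⟨-, o, ho, -⟩
      exacts [h, absurd ho (hmax o)]
    | @head S S' hstep hrest ih =>
      intro hYS hinv
      rcases dichotomy S hYS (hle (.head hstep hrest)) hinv with h | ⟨hOS, o, ho, hbest⟩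
      · exact h
      obtain ⟨u, hu, hubest, rfl⟩ := hstep
      exact ih (hYS.trans (subset_insert u S)) (step S u hYS hOS hu.1
        (fun w hw => (hbest w hw).trans (hubest o ho)) hinv)
  exact key Y hsteps subset_rfl (by simp)

theorem GreedilyAugments.affordable {N : Network V F} {S T : Finset V} (hS : N.Affordable S)
    (h : N.GreedilyAugments S T) : N.Affordable T := by
  obtain ⟨h, -⟩ := h
  induction h with
  | refl => exact hS
  | tail _ hstep _ =>
    obtain ⟨u, hu, -, rfl⟩ := hstep
    exact hu.2

theorem IsEnumerationGreedy.affordable {N : Network V F} (budget_nonneg : 0 ≤ N.budget)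
    {U : Finset V} (h : N.IsEnumerationGreedy U) : N.Affordable U := by
  obtain ⟨U₁, U₂, aug, h1, haug, h2, hU, -, -⟩ := h
  have hempty : N.Affordable ∅ := by simpa [Affordable] using budget_nonneg
  rcases hU with rfl | rfl
  · rcases Set.eq_empty_or_nonempty {S | N.Affordable S ∧ (S.card = 1 ∨ S.card = 2)} with h | h
    · rw [h1.2 h]; exact hempty
    · exact (h1.1 h).1.1
  · rcases Set.eq_empty_or_nonempty (aug '' N.triples) with h | h
    · rw [h2.2 h]; exact hempty
    · obtain ⟨S, hS, heq⟩ := (h2.1 h).1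
      exact (heq ▸ haug S hS).affordable hS.1

theorem IsEnumerationGreedy.le_relaxedValue {N : Network V F} (mono : Monotone N.relaxedValue)
    (submod : ∀ S T, N.relaxedValue (S ∪ T) + N.relaxedValue (S ∩ T) ≤
      N.relaxedValue S + N.relaxedValue T) (h0 : N.relaxedValue ∅ = 0)
    (cost_pos : ∀ v, 0 < N.cost v) {U O : Finset V} (h : N.IsEnumerationGreedy U)
    (hO : N.Affordable O) :
    (1 - 1 / Real.exp 1) * N.relaxedValue O ≤ N.relaxedValue U := by
  obtain ⟨U₁, U₂, aug, h1, haug, h2, -, hU1, hU2⟩ := h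
  have hpos : 0 ≤ 1 / Real.exp 1 * N.relaxedValue O :=
    mul_nonneg (by positivity) (h0 ▸ mono (empty_subset O))
  by_cases hO3 : 3 ≤ O.card
  · obtain ⟨Y, hYO, hYc, hY⟩ := exists_greedy_triple mono submod h0 hO3
    have hYt : Y ∈ N.triples :=
      ⟨(sum_le_sum_of_subset_of_nonneg hYO fun v _ _ => (cost_pos v).le).trans hO, hYc⟩
    have hmem : aug Y ∈ aug '' N.triples := ⟨Y, hYt, rfl⟩
    exact (le_relaxedValue_of_greedilyAugments mono submod h0 cost_pos hO hYO hY
      (haug Y hYt)).trans (((h2.1 ⟨_, hmem⟩).2 _ hmem).trans hU2)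
  · rcases Finset.eq_empty_or_nonempty O with rfl | hne
    · rw [h0, mul_zero, ← h0]; exact mono (empty_subset U)
    · have hmem : O ∈ {S | N.Affordable S ∧ (S.card = 1 ∨ S.card = 2)} :=
        ⟨hO, by have := hne.card_pos; omega⟩
      have := (h1.1 ⟨_, hmem⟩).2 _ hmem
      linarith

/-! ### The placement algorithms always have an output -/

theorem exists_greedyRun [Fintype V] (N : Network V F) {n : ℕ} (hn : n ≤ Fintype.card V) :
    ∃ U, N.GreedyRun n U := by
  induction n with
  | zero => exact ⟨∅, .zero⟩
  | succ n ih =>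
    obtain ⟨U, hU⟩ := ih (by omega)
    have hne : (univ \ U).Nonempty := by
      rw [← card_pos, card_sdiff_of_subset (subset_univ U), hU.card_eq, card_univ]
      omega
    obtain ⟨u, hu, hbest⟩ := exists_max_image (univ \ U)
      (fun w => N.relaxedValue (insert w U) - N.relaxedValue U) hne
    exact ⟨insert u U, .succ hU (mem_sdiff.1 hu).2 fun w hw => hbest w (by simp [hw])⟩

theorem exists_greedilyAugments [Fintype V] (N : Network V F) (S : Finset V) :
    ∃ T, N.GreedilyAugments S T := by
  classical
  induction hn : Fintype.card V - S.card using Nat.strong_induction_on generalizing S with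
  | _ n ih =>
    by_cases hne : (univ.filter (N.CanAdd S)).Nonempty
    · obtain ⟨u, hu, hbest⟩ := exists_max_image _ (N.relativeGain S) hne
      have hu' : N.CanAdd S u := (mem_filter.1 hu).2
      have hcard := card_insert_of_notMem hu'.1
      have hle := card_le_univ (insert u S)
      obtain ⟨T, hT, hmax⟩ := ih _ (by omega) (insert u S) rfl
      exact ⟨T, .head ⟨u, hu', fun w hw => hbest w (by simp [hw]), rfl⟩ hT, hmax⟩
    · refine ⟨S, .refl, fun u hu => hne ⟨u, by simp [hu]⟩⟩

theorem exists_isBest [Fintype V] (N : Network V F) (C : Set (Finset V)) :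
    ∃ U, N.IsBest C U := by
  rcases C.eq_empty_or_nonempty with h | h
  · exact ⟨∅, fun h' => absurd h h'.ne_empty, fun _ => rfl⟩
  · obtain ⟨U, hU, hmax⟩ := Set.exists_max_image C N.relaxedValue (Set.toFinite _) h
    exact ⟨U, fun _ => ⟨hU, hmax⟩, fun h' => absurd h' h.ne_empty⟩

theorem exists_isEnumerationGreedy [Fintype V] (N : Network V F) :
    ∃ U, N.IsEnumerationGreedy U := by
  choose aug haug using N.exists_greedilyAugments
  obtain ⟨U₁, h1⟩ := N.exists_isBest {S | N.Affordable S ∧ (S.card = 1 ∨ S.card = 2)}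
  obtain ⟨U₂, h2⟩ := N.exists_isBest (aug '' N.triples)
  rcases le_total (N.relaxedValue U₁) (N.relaxedValue U₂) with h | h
  · exact ⟨U₂, U₁, U₂, aug, h1, fun S _ => haug S, h2, .inr rfl, h, le_rfl⟩
  · exact ⟨U₁, U₁, U₂, aug, h1, fun S _ => haug S, h2, .inl rfl, le_rfl, h⟩

theorem exists_isSubmodularGreedy [Fintype V] (N : Network V F) (cost_pos : ∀ v, 0 < N.cost v)
    (hcost : ∃ b, ∀ v, N.cost v = b) : ∃ U, N.IsSubmodularGreedy U := by
  obtain ⟨b, hb, hcost⟩ : ∃ b, 0 < b ∧ ∀ v, N.cost v = b := by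
    -- Without nodes the given uniform cost may fail to be positive, so `1` is used instead.
    rcases isEmpty_or_nonempty V with h | ⟨⟨v⟩⟩
    · exact ⟨1, one_pos, fun v => h.elim v⟩
    · obtain ⟨b, hb⟩ := hcost
      exact ⟨b, hb v ▸ cost_pos v, hb⟩
  obtain ⟨U, hU⟩ := N.exists_greedyRun (n := min ⌊N.budget / b⌋₊ (Fintype.card V))
    (min_le_right _ _)
  exact ⟨U, b, hb, hcost, hU⟩

end Network

end VPCA

namespace VPCA.Network

variable {V F : Type*} [DecidableEq V] [Fintype F] [DecidableEq F]

open Finset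

set_option linter.unusedSectionVars false

/-! ### Greedy capacity allocation -/

/-- Assignments that respect the capacities and use only VNF-nodes on the paths of the flows. -/
def Allocation (N : Network V F) (U : Finset V) (x : F → V → ℝ) : Prop :=
  N.CapacityFeasible U x ∧ ∀ f, ∀ v ∉ N.nodesOn U f, x f v = 0

theorem Allocation.zero (N : Network V F) (cap_nonneg : ∀ v, 0 ≤ N.cap v) (U : Finset V) :
    N.Allocation U 0 :=
  ⟨⟨fun _ _ => le_rfl, fun v _ => by simpa using cap_nonneg v, fun _ _ _ => rfl⟩,
    fun _ _ _ => rfl⟩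

theorem Allocation.update {N : Network V F} {U : Finset V} {x : F → V → ℝ}
    (hx : N.Allocation U x) {f : F} (hf : x f = 0) {z : V → ℝ} (nonneg : ∀ v, 0 ≤ z v)
    (supp : ∀ v ∉ N.nodesOn U f, z v = 0) (le_rem : ∀ v ∈ N.nodesOn U f, z v ≤ N.remCap x v) :
    N.Allocation U (Function.update x f z) := by
  obtain ⟨⟨h0, hc, -⟩, hp⟩ := hx
  have hp' : ∀ g, ∀ v ∉ N.nodesOn U g, Function.update x f z g v = 0 := by
    intro g v hv
    by_cases hg : g = f
    · subst hg; simpa using supp v hv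
    · simpa [hg] using hp g v hv
  refine ⟨⟨?_, ?_, fun g v hv => hp' g v fun h => hv (mem_inter.1 h).2⟩, hp'⟩
  · intro g v
    by_cases hg : g = f
    · subst hg; simpa using nonneg v
    · simpa [hg] using h0 g v
  · intro v hv
    rw [sum_update_apply, hf]
    simp only [Pi.zero_apply, sub_zero]
    by_cases hvf : v ∈ N.nodesOn U f
    · have := le_rem v hvf
      unfold remCap at this
      linarith
    · rw [supp v hvf, add_zero]; exact hc v hv

/-- What Phase I achieves when it is run on a sorted list of flows: flows are assigned completely
or not at all, and the nodes on the paths of the unassigned flows are at least half full. -/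
theorem PhaseI.spec {N : Network V F} (rate_nonneg : ∀ f, 0 ≤ N.rate f)
    (rate_le_cap : ∀ f v, N.rate f ≤ N.cap v) {U : Finset V} {l rest : List F} {x y : F → V → ℝ}
    (run : N.PhaseI U l x rest y) (hl : l.Nodup)
    (hsorted : l.Pairwise fun f g => N.rate g ≤ N.rate f) (hx : N.Allocation U x)
    (hx0 : ∀ f ∈ l, x f = 0)
    (hload : ∀ f ∈ l, ∀ v, ∑ g, x g v = 0 ∨ N.rate f ≤ ∑ g, x g v) :
    N.Allocation U y ∧ (∀ f ∉ l, y f = x f) ∧ rest.Sublist l ∧ (∀ f ∈ rest, y f = 0) ∧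
      (∀ f ∈ l, f ∉ rest → ∑ v ∈ N.nodesOn U f, y f v = N.rate f) ∧
      (∀ v, ∑ g, x g v ≤ ∑ g, y g v) ∧
      ∀ f ∈ rest, ∀ v ∈ N.nodesOn U f, N.cap v ≤ 2 * ∑ g, y g v := by
  -- The invariant `hload` says that each load is zero or at least every rate still to come. A flow
  -- that does not fit at `v` thus finds a nonzero load (as its rate is at most the capacity), which
  -- is at least its rate and hence more than the remaining capacity. Later loads only grow.
  induction run with
  | nil x => exact ⟨hx, fun _ _ => rfl, .slnil, by simp, by simp, fun _ => le_rfl, by simp⟩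
  | @assign f l rest x y v hv fits run ih =>
    obtain ⟨hfl, hl'⟩ := List.nodup_cons.1 hl
    obtain ⟨hle, hs'⟩ := List.pairwise_cons.1 hsorted
    have hxf := hx0 f List.mem_cons_self
    have hnn : ∀ w, 0 ≤ (Pi.single v (N.rate f) : V → ℝ) w := fun w =>
      (Pi.single_nonneg.2 (rate_nonneg f) : (0 : V → ℝ) ≤ Pi.single v (N.rate f)) w
    have hsum : ∀ w, ∑ g, Function.update x f (Pi.single v (N.rate f)) g w =
        ∑ g, x g w + (Pi.single v (N.rate f) : V → ℝ) w := fun w => by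
      rw [sum_update_apply, hxf]; simp
    have hx' : N.Allocation U (Function.update x f (Pi.single v (N.rate f))) := by
      have hne : ∀ w ∉ N.nodesOn U f, w ≠ v := fun w hw h => hw (h ▸ hv)
      refine hx.update hxf hnn (fun w hw => Pi.single_eq_of_ne (hne w hw) _) fun w hw => ?_
      by_cases hwv : w = v
      · subst hwv; simpa using fits
      · rw [Pi.single_eq_of_ne hwv]
        have := hx.1.2.1 w (mem_inter.1 hw).2
        unfold remCap; linarith
    obtain ⟨i1, i2, i3, i4, i5, i6, i7⟩ := ih hl' hs' hx' (by
      intro g hg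
      have : g ≠ f := fun h => hfl (h ▸ hg)
      rw [Function.update_of_ne this]
      exact hx0 g (List.mem_cons_of_mem f hg)) (by
      intro g hg w
      rw [hsum]
      by_cases hwv : w = v
      · subst hwv
        right
        have : 0 ≤ ∑ g, x g w := sum_nonneg fun g _ => hx.1.1 g w
        rw [Pi.single_eq_same]
        linarith [hle g hg]
      · rw [Pi.single_eq_of_ne hwv, add_zero]
        exact hload g (List.mem_cons_of_mem f hg) w)
    refine ⟨i1, ?_, i3.cons f, i4, ?_, ?_, i7⟩
    · intro g hg
      rw [List.mem_cons, not_or] at hg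
      rw [i2 g hg.2, Function.update_of_ne hg.1]
    · intro g hg hgr
      rcases List.mem_cons.1 hg with rfl | hg
      · rw [i2 g hfl, Function.update_self]
        simp [hv]
      · exact i5 g hg hgr
    · intro w
      have := i6 w
      rw [hsum] at this
      linarith [hnn w]
  | @skip f l rest x y none_fits run ih =>
    obtain ⟨hfl, hl'⟩ := List.nodup_cons.1 hl
    obtain ⟨hle, hs'⟩ := List.pairwise_cons.1 hsorted
    obtain ⟨i1, i2, i3, i4, i5, i6, i7⟩ := ih hl' hs' hx
      (fun g hg => hx0 g (List.mem_cons_of_mem f hg))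
      (fun g hg => hload g (List.mem_cons_of_mem f hg))
    refine ⟨i1, fun g hg => i2 g fun h => hg (List.mem_cons_of_mem f h), i3.cons_cons f,
      ?_, ?_, i6, ?_⟩
    · intro g hg
      rcases List.mem_cons.1 hg with rfl | hg
      · rw [i2 g hfl]; exact hx0 g List.mem_cons_self
      · exact i4 g hg
    · intro g hg hgr
      rw [List.mem_cons, not_or] at hgr
      rcases List.mem_cons.1 hg with rfl | hg
      · exact absurd rfl hgr.1
      · exact i5 g hg hgr.2
    · intro g hg v hv
      rcases List.mem_cons.1 hg with rfl | hg
      · have h1 := none_fits v hv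
        have h2 := rate_le_cap g v
        unfold remCap at h1
        rcases hload g List.mem_cons_self v with h | h
        · linarith
        · linarith [i6 v]
      · exact i7 g hg v hv

/-- The bound does not use the gain of Phase II, only that feasibility survives and that flows
completed in Phase I stay untouched. -/
theorem PhaseII.spec {N : Network V F} {U : Finset V} {l : List F} {x y : F → V → ℝ}
    (run : N.PhaseII U l x y) (hl : l.Nodup) (hx : N.Allocation U x) (hx0 : ∀ f ∈ l, x f = 0) :
    N.Allocation U y ∧ ∀ f ∉ l, y f = x f := by
  induction run with
  | nil x => exact ⟨hx, fun _ _ => rfl⟩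
  | @assign f l x y z fits nonneg supp le_rem total run ih =>
    obtain ⟨hfl, hl'⟩ := List.nodup_cons.1 hl
    obtain ⟨i1, i2⟩ := ih hl' (hx.update (hx0 f List.mem_cons_self) nonneg supp le_rem) (by
      intro g hg
      have : g ≠ f := fun h => hfl (h ▸ hg)
      rw [Function.update_of_ne this]
      exact hx0 g (List.mem_cons_of_mem f hg))
    refine ⟨i1, fun g hg => ?_⟩
    rw [List.mem_cons, not_or] at hg
    rw [i2 g hg.2, Function.update_of_ne hg.1]
  | @skip f l x y too_large run ih =>
    obtain ⟨i1, i2⟩ := ih (List.nodup_cons.1 hl).2 hx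
      (fun g hg => hx0 g (List.mem_cons_of_mem f hg))
    exact ⟨i1, fun g hg => i2 g fun h => hg (List.mem_cons_of_mem f h)⟩

/-- GCA yields a feasible allocation whose value is at least a third of the relaxed optimum. -/
theorem IsGCA.spec {N : Network V F} (rate_nonneg : ∀ f, 0 ≤ N.rate f)
    (cap_nonneg : ∀ v, 0 ≤ N.cap v) (rate_le_cap : ∀ f v, N.rate f ≤ N.cap v) {U : Finset V}
    {y : F → V → ℝ} (h : N.IsGCA U y) :
    N.CapacityFeasible U y ∧ N.relaxedValue U ≤ 3 * N.fullyProcessed U y := by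
  obtain ⟨l, rest, x, ⟨hl, hmem, hsorted⟩, run1, run2⟩ := h
  obtain ⟨hxA, hxout, hsub, hxrest, hxfull, -, hhalf⟩ := run1.spec rate_nonneg rate_le_cap hl
    hsorted (.zero N cap_nonneg U) (fun _ _ => rfl) (fun _ _ _ => .inl (by simp))
  obtain ⟨hyA, hyout⟩ := run2.spec (hsub.nodup hl) hxA hxrest
  refine ⟨hyA.1, ?_⟩
  -- `T` consists of the flows skipped in Phase I and those missing `U`; the latter bring no node of
  -- `U` into the cut.
  set T : Finset F := univ.filter fun f => f ∈ rest ∨ f ∉ l with hT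
  have hTc : ∀ f ∈ Tᶜ, f ∈ l ∧ f ∉ rest := by
    intro f hf
    simpa [hT, not_or, and_comm] using hf
  have hnodes : ∀ f, ∑ v ∈ U, x f v = ∑ v ∈ N.nodesOn U f, x f v := fun f =>
    (sum_subset inter_subset_right fun v _ hv => hxA.2 f v hv).symm
  have hload : ∑ v ∈ U, ∑ f, x f v = ∑ f ∈ Tᶜ, N.rate f := by
    rw [sum_comm]
    symm
    refine (sum_congr rfl fun f hf => ?_).trans (sum_subset (subset_univ Tᶜ) fun f _ hf => ?_)
    · rw [hnodes, hxfull f (hTc f hf).1 (hTc f hf).2]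
    · have hf' : f ∈ rest ∨ f ∉ l :=
        (mem_filter.1 (not_not.1 fun h => hf (mem_compl.2 h))).2
      rcases hf' with h | h
      · simp [hxrest f h]
      · simp [hxout f h]
  have hcut : N.relaxedValue U ≤ 3 * ∑ f ∈ Tᶜ, N.rate f := by
    refine (N.relaxedValue_le_cut rate_nonneg cap_nonneg T U).trans ?_
    have : (∑ v ∈ U, if ∃ f ∈ T, v ∈ N.path f then N.cap v else 0) ≤
        ∑ v ∈ U, 2 * ∑ f, x f v := by
      refine sum_le_sum fun v hv => ?_
      split_ifs with h
      · obtain ⟨f, hf, hfv⟩ := h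
        have hvf : v ∈ N.nodesOn U f := mem_inter.2 ⟨hfv, hv⟩
        have hfl : f ∈ l := (hmem f).2 (mem_filter.2 ⟨mem_univ f, v, hvf⟩)
        have hfr : f ∈ rest := (mem_filter.1 hf).2.resolve_right (not_not.2 hfl)
        exact hhalf f hfr v hvf
      · exact mul_nonneg zero_le_two (sum_nonneg fun f _ => hxA.1.1 f v)
    rw [← mul_sum, hload] at this
    unfold cut
    linarith
  have hval : ∑ f ∈ Tᶜ, N.rate f ≤ N.fullyProcessed U y := by
    unfold fullyProcessed
    rw [← sum_compl_add_sum T]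
    refine le_add_of_le_of_nonneg (sum_le_sum fun f hf => ?_) (sum_nonneg fun f _ => ?_)
    · rw [hyout f (hTc f hf).2, hxfull f (hTc f hf).1 (hTc f hf).2, if_pos le_rfl]
    · split_ifs
      exacts [rate_nonneg f, le_rfl]
  linarith

/-! ### Greedy capacity allocation always has an output -/

theorem exists_phaseI (N : Network V F) (U : Finset V) (l : List F) (x : F → V → ℝ) :
    ∃ rest y, N.PhaseI U l x rest y := by
  induction l generalizing x with
  | nil => exact ⟨[], x, .nil x⟩
  | cons f l ih =>
    by_cases h : ∃ v ∈ N.nodesOn U f, N.rate f ≤ N.remCap x v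
    · obtain ⟨v, hv, fits⟩ := h
      obtain ⟨rest, y, run⟩ := ih (Function.update x f (Pi.single v (N.rate f)))
      exact ⟨rest, y, .assign v hv fits run⟩
    · push Not at h
      obtain ⟨rest, y, run⟩ := ih x
      exact ⟨f :: rest, y, .skip h run⟩

theorem exists_phaseII (N : Network V F) (rate_nonneg : ∀ f, 0 ≤ N.rate f) (U : Finset V)
    (l : List F) (x : F → V → ℝ) (hl : l.Nodup) (hx : N.Allocation U x)
    (hx0 : ∀ f ∈ l, x f = 0) : ∃ y, N.PhaseII U l x y := by
  induction l generalizing x with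
  | nil => exact ⟨x, .nil x⟩
  | cons f l ih =>
    obtain ⟨hfl, hl'⟩ := List.nodup_cons.1 hl
    by_cases fits : N.rate f ≤ ∑ v ∈ N.nodesOn U f, N.remCap x v
    · set R := ∑ v ∈ N.nodesOn U f, N.remCap x v with hR
      have hrem : ∀ v ∈ N.nodesOn U f, 0 ≤ N.remCap x v := fun v hv =>
        sub_nonneg.2 (hx.1.2.1 v (mem_inter.1 hv).2)
      have hRnn : 0 ≤ R := (rate_nonneg f).trans fits
      have hfrac : 0 ≤ N.rate f / R := div_nonneg (rate_nonneg f) hRnn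
      -- Split in proportion to the remaining capacities. If `R = 0`, the rate vanishes too and the
      -- default value of division by zero is harmless.
      set z : V → ℝ := fun v => if v ∈ N.nodesOn U f then N.rate f / R * N.remCap x v else 0
        with hz
      have nonneg : ∀ v, 0 ≤ z v := fun v => by
        simp only [hz]; split_ifs with h
        exacts [mul_nonneg hfrac (hrem v h), le_rfl]
      have supp : ∀ v ∉ N.nodesOn U f, z v = 0 := fun v hv => if_neg hv
      have le_rem : ∀ v ∈ N.nodesOn U f, z v ≤ N.remCap x v := fun v hv => by
        simp only [hz, if_pos hv]
        exact mul_le_of_le_one_left (hrem v hv) (div_le_one_of_le₀ fits hRnn)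
      have total : ∑ v ∈ N.nodesOn U f, z v = N.rate f := by
        rw [sum_congr rfl fun v hv => (if_pos hv : z v = _), ← mul_sum, ← hR]
        rcases hRnn.eq_or_lt with h | h
        · rw [← h, mul_zero]
          linarith [rate_nonneg f]
        · exact div_mul_cancel₀ _ h.ne'
      obtain ⟨y, run⟩ := ih (Function.update x f z) hl'
        (hx.update (hx0 f List.mem_cons_self) nonneg supp le_rem) (by
          intro g hg
          have : g ≠ f := fun h => hfl (h ▸ hg)
          rw [Function.update_of_ne this]
          exact hx0 g (List.mem_cons_of_mem f hg))
      exact ⟨y, .assign z fits nonneg supp le_rem total run⟩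
    · obtain ⟨y, run⟩ := ih x hl' hx fun g hg => hx0 g (List.mem_cons_of_mem f hg)
      exact ⟨y, .skip (not_le.1 fits) run⟩

theorem exists_isSortedFlows (N : Network V F) (U : Finset V) : ∃ l, N.IsSortedFlows U l := by
  let l := (N.flowsThrough U).toList.mergeSort fun f g => decide (N.rate g ≤ N.rate f)
  have hperm : l.Perm (N.flowsThrough U).toList := List.mergeSort_perm _ _
  refine ⟨l, hperm.nodup_iff.2 (nodup_toList _), fun f => by rw [hperm.mem_iff, mem_toList], ?_⟩
  have := List.pairwise_mergeSort (le := fun f g => decide (N.rate g ≤ N.rate f))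
    (fun a b c hab hbc => by
      simp only [decide_eq_true_eq] at *
      exact hbc.trans hab)
    (fun a b => by simpa using le_total (N.rate b) (N.rate a)) (N.flowsThrough U).toList
  simpa using this

theorem exists_isGCA (N : Network V F) (rate_nonneg : ∀ f, 0 ≤ N.rate f)
    (cap_nonneg : ∀ v, 0 ≤ N.cap v) (rate_le_cap : ∀ f v, N.rate f ≤ N.cap v) (U : Finset V) :
    ∃ y, N.IsGCA U y := by
  obtain ⟨l, hl⟩ := N.exists_isSortedFlows U
  obtain ⟨rest, x, run1⟩ := N.exists_phaseI U l 0
  obtain ⟨hxA, -, hsub, hxrest, -⟩ := run1.spec rate_nonneg rate_le_cap hl.1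
    hl.2.2 (.zero N cap_nonneg U) (fun _ _ => rfl) (fun _ _ _ => .inl (by simp))
  obtain ⟨y, run2⟩ := N.exists_phaseII rate_nonneg U rest x (hsub.nodup hl.1) hxA hxrest
  exact ⟨y, l, rest, x, hl, run1, run2⟩

end VPCA.Network

/-! ### Combination of placement and allocation -/

theorem theorem4 {V F : Type*} [Fintype V] [DecidableEq V] [Fintype F] [DecidableEq F]
    (N : VPCA.Network V F)
    (rate_nonneg : ∀ f, 0 ≤ N.rate f)
    (cap_nonneg : ∀ v, 0 ≤ N.cap v)
    (rate_le_cap : ∀ f v, N.rate f ≤ N.cap v)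
    (cost_pos : ∀ v, 0 < N.cost v)
    (budget_nonneg : 0 ≤ N.budget)
    (alg : VPCA.PlacementAlg) (halg : N.Applicable alg) :
    (∃ U x, N.IsRPGCA alg U x) ∧
    ∀ U x, N.IsRPGCA alg U x →
      N.Feasible U x ∧
      ∀ U' x', N.Feasible U' x' →
        1 / 3 * (1 - 1 / Real.exp 1) * N.fullyProcessed U' x' ≤ N.fullyProcessed U x := by
  have mono := N.relaxedValue_mono rate_nonneg cap_nonneg
  have submod := N.relaxedValue_union_add_inter_le rate_nonneg cap_nonneg
  have h0 := N.relaxedValue_empty rate_nonneg cap_nonneg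
  refine ⟨?_, ?_⟩
  · obtain ⟨U, hU⟩ : ∃ U, N.IsPlacement alg U := by
      cases alg with
      | submodularGreedy => exact N.exists_isSubmodularGreedy cost_pos halg
      | enumerationGreedy => exact N.exists_isEnumerationGreedy
    obtain ⟨x, hx⟩ := N.exists_isGCA rate_nonneg cap_nonneg rate_le_cap U
    exact ⟨U, x, hU, hx⟩
  · rintro U x ⟨hU, hx⟩
    obtain ⟨hfeas, hthird⟩ := hx.spec rate_nonneg cap_nonneg rate_le_cap
    have hplace : N.Affordable U ∧ ∀ O, N.Affordable O →
        (1 - 1 / Real.exp 1) * N.relaxedValue O ≤ N.relaxedValue U := by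
      cases alg with
      | submodularGreedy =>
        exact ⟨VPCA.Network.IsSubmodularGreedy.affordable budget_nonneg hU, fun O hO =>
          VPCA.Network.IsSubmodularGreedy.le_relaxedValue mono submod h0 hU hO⟩
      | enumerationGreedy =>
        exact ⟨VPCA.Network.IsEnumerationGreedy.affordable budget_nonneg hU, fun O hO =>
          VPCA.Network.IsEnumerationGreedy.le_relaxedValue mono submod h0 cost_pos hU hO⟩
    refine ⟨⟨hplace.1, hfeas⟩, fun U' x' h' => ?_⟩
    have h1 := N.fullyProcessed_le_relaxedValue rate_nonneg cap_nonneg h'.2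
    have h2 := hplace.2 U' h'.1
    have he : 0 ≤ 1 - 1 / Real.exp 1 :=
      sub_nonneg.2 (div_le_one_of_le₀ (Real.one_le_exp zero_le_one) (Real.exp_pos 1).le)
    have h3 := mul_le_mul_of_nonneg_left h1 he
    linarith
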